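/- Let $D$ be a directed graph (of any cardinality) with vertex set $V$. Then the end space of $D$ and the end space of the connectoid $(V,\mathcal C)$ corresponding to $D$ are homeomorphic. The notions are as follows. **Ends of $D$.** For $C\subseteq V$ let $D[C]$ be the subdigraph induced on $C$, and for finite $A\subseteq V$ let $D-A=D[V\setminus A]$. A strong component of $D-A$ is a maximal nonempty strongly connected subdigraph of $D-A$. A directed ray in $D$ is given by a sequence $v_0,v_1,\dots$ of distinct vertices such that $v_nv_{n+1}$ is an edge of $D$ for every $n$; its tails are the rays $v_m,v_{m+1},\dots$. A directed ray is solid if for every finite $A\subseteq V$ it has a tail in a strong component of $D-A$. Two solid rays are equivalent if for every finite $A\subseteq V$ they have tails in the same strong component of $D-A$. The ends of $D$ are the equivalence classes of solid rays. For an end $\omega$ and a finite $A\subseteq V$, $K(A,\omega)$ is the strong component of $D-A$ that contains tails of all rays in $\omega$. The end space of $D$ is the set of ends with the topology generated by the sets $\{\omega : K(A,\omega)=K\}$, for finite $A\subseteq V$ and strong components $K$ of $D-A$. **Connectoids and their ends.** Let $S$ be a set and let $\mathcal F$ be a set of finite subsets of $S$ that contains $\emptyset$ and all singletons, and such that $F\cup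 F'\in\mathcal F$ for all $F,F'\in\mathcal F$ with $F\cap F'\ne\emptyset$. A set $C\subseteq S$ is connected if for all $x,y\in C$ there is $F\in\mathcal F$ with $x,y\in F\subseteq C$. With $\mathcal C$ the set of connected sets, $(S,\mathcal C)$ is the connectoid induced by $\mathcal F$. A component of $U\subseteq S$ is a maximal nonempty connected subset of $U$. A necklace is a connected set $N$ for which there are finite connected sets $H_n$ ($n\in\mathbb N$) with $N=\bigcup_n H_n$ and such that $H_i\cap H_j\neq\emptyset$ if and only if $|i-j|\le 1$. For a necklace $N$ and a finite $X\subseteq S$, the $X$-tail of $N$ is the unique component of $N\setminus X$ that contains all but finitely many elements of $N$. Two necklaces are equivalent if for every finite $X\subseteq S$ their $X$-tails are contained in the same component of $S\setminus X$. The ends of $(S,\mathcal C)$ are the equivalence classes of necklaces, and $K(X,\omega)$ denotes the component of $S\setminus X$ that contains the $X$-tails of all necklaces in $\omega$. The end space of $(S,\mathcal C)$ is the set of ends with the topology generated by the sets $\{\omega : K(X,\omega)=K\}$, for finite $X\subseteq S$ and components $K$ of $S\setminus X$. **The connectoid corresponding to $D$** is the connectoid on $S=V$ induced by the set $\mathcal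 F$ of the vertex sets of all finite strongly connected subdigraphs of $D$, together with $\emptyset$. -/

import Mathlib

/-- A connectoid on the ground set `S`, given by the family `finConn` of its finite connected sets:
a family of finite sets that contains `∅` and all singletons and is closed under unions of
intersecting members. -/
structure Connectoid (S : Type*) where
  /-- The finite connected sets. -/
  finConn : Set (Set S)
  finite_of_mem : ∀ F ∈ finConn, F.Finite
  union_mem : ∀ F ∈ finConn, ∀ F' ∈ finConn, (F ∩ F').Nonempty → F ∪ F' ∈ finConn
  singleton_mem : ∀ s : S, {s} ∈ finConn
  empty_mem : ∅ ∈ finConn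

namespace Connectoid

variable {S : Type*} (𝒮 : Connectoid S)

/-- `C` is connected if any two elements of `C` lie in a common finite connected subset of `C`. -/
def IsConnected (C : Set S) : Prop :=
  ∀ x ∈ C, ∀ y ∈ C, ∃ F ∈ 𝒮.finConn, F ⊆ C ∧ x ∈ F ∧ y ∈ F

/-- `K` is a component of `U`, i.e. a maximal (nonempty) connected subset of `U`. -/
def IsComponent (U K : Set S) : Prop :=
  Maximal (fun C : Set S => C.Nonempty ∧ C ⊆ U ∧ 𝒮.IsConnected C) K

/-- `H` is a witness of the set `N`. -/
structure IsWitness (H : ℕ → Set S) (N : Set S) : Prop where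
  finite : ∀ n, (H n).Finite
  isConnected : ∀ n, 𝒮.IsConnected (H n)
  eq_iUnion : N = ⋃ n, H n
  inter_nonempty_iff : ∀ i j, (H i ∩ H j).Nonempty ↔ i ≤ j + 1 ∧ j ≤ i + 1

/-- A necklace is a connected set that has a witness. -/
def IsNecklace (N : Set S) : Prop :=
  𝒮.IsConnected N ∧ ∃ H : ℕ → Set S, 𝒮.IsWitness H N

/-- The necklaces of a connectoid. -/
def Necklace : Type _ := {N : Set S // 𝒮.IsNecklace N}

/-- `T` is the `X`-tail of `N`: the component of `N \ X` that contains all but finitely many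
elements of `N`. -/
def IsTail (X N T : Set S) : Prop :=
  𝒮.IsComponent (N \ X) T ∧ (N \ T).Finite

/-- The `X`-tail of `N` is contained in `K`. -/
def TailIn (X N K : Set S) : Prop :=
  ∃ T, 𝒮.IsTail X N T ∧ T ⊆ K

/-- Two sets are equivalent if for every finite `X` their `X`-tails are contained in the same
component of `S \ X`. -/
def Equivalent (N N' : Set S) : Prop :=
  ∀ X : Set S, X.Finite → ∃ K, 𝒮.IsComponent Xᶜ K ∧ 𝒮.TailIn X N K ∧ 𝒮.TailIn X N' K

variable {𝒮}

theorem IsConnected.union {C C' : Set S} (h : 𝒮.IsConnected C) (h' : 𝒮.IsConnected C')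
    (hne : (C ∩ C').Nonempty) : 𝒮.IsConnected (C ∪ C') := by
  obtain ⟨z, hz, hz'⟩ := hne
  have key : ∀ x ∈ C ∪ C', ∃ F ∈ 𝒮.finConn, F ⊆ C ∪ C' ∧ x ∈ F ∧ z ∈ F := by
    rintro x (hx | hx)
    · obtain ⟨F, hF, hs, h1, h2⟩ := h x hx z hz
      exact ⟨F, hF, hs.trans Set.subset_union_left, h1, h2⟩
    · obtain ⟨F, hF, hs, h1, h2⟩ := h' x hx z hz'
      exact ⟨F, hF, hs.trans Set.subset_union_right, h1, h2⟩
  intro x hx y hy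
  obtain ⟨F, hF, hs, h1, h2⟩ := key x hx
  obtain ⟨F', hF', hs', h1', h2'⟩ := key y hy
  exact ⟨F ∪ F', 𝒮.union_mem F hF F' hF' ⟨z, h2, h2'⟩, Set.union_subset hs hs', Or.inl h1,
    Or.inr h1'⟩

theorem IsComponent.eq_of_inter_nonempty {U K K' : Set S} (h : 𝒮.IsComponent U K)
    (h' : 𝒮.IsComponent U K') (hne : (K ∩ K').Nonempty) : K = K' := by
  have hU : (K ∪ K').Nonempty ∧ K ∪ K' ⊆ U ∧ 𝒮.IsConnected (K ∪ K') :=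
    ⟨h.prop.1.inl, Set.union_subset h.prop.2.1 h'.prop.2.1, h.prop.2.2.union h'.prop.2.2 hne⟩
  rw [h.eq_of_subset hU Set.subset_union_left]
  exact (h'.eq_of_subset hU Set.subset_union_right).symm

theorem IsConnected.exists_isComponent {U C : Set S} (hC : 𝒮.IsConnected C) (hne : C.Nonempty)
    (hU : C ⊆ U) : ∃ K, 𝒮.IsComponent U K ∧ C ⊆ K := by
  obtain ⟨x, hx⟩ := hne
  have hsub : ∀ C' ⊆ U, 𝒮.IsConnected C' → x ∈ C' →
      C' ⊆ {y | ∃ F ∈ 𝒮.finConn, F ⊆ U ∧ x ∈ F ∧ y ∈ F} := by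
    intro C' hU' hC' hx' y hy
    obtain ⟨F, hF, hs, h1, h2⟩ := hC' x hx' y hy
    exact ⟨F, hF, hs.trans hU', h1, h2⟩
  refine ⟨{y | ∃ F ∈ 𝒮.finConn, F ⊆ U ∧ x ∈ F ∧ y ∈ F}, ⟨⟨⟨x, hsub C hU hC hx hx⟩, ?_, ?_⟩, ?_⟩,
    hsub C hU hC hx⟩
  · rintro y ⟨F, -, hs, -, hy⟩
    exact hs hy
  · rintro y ⟨F, hF, hs, hxF, hy⟩ z ⟨F', hF', hs', hxF', hz⟩
    have hm := 𝒮.union_mem F hF F' hF' ⟨x, hxF, hxF'⟩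
    exact ⟨F ∪ F', hm, fun w hw => ⟨F ∪ F', hm, Set.union_subset hs hs', Or.inl hxF, hw⟩,
      Or.inl hy, Or.inr hz⟩
  · rintro C' ⟨-, hU', hC'⟩ hle
    exact hsub C' hU' hC' (hle (hsub C hU hC hx hx))

theorem IsWitness.nonempty {H : ℕ → Set S} {N : Set S} (h : 𝒮.IsWitness H N) (n : ℕ) :
    (H n).Nonempty :=
  ((h.inter_nonempty_iff n n).2 ⟨n.le_succ, n.le_succ⟩).mono Set.inter_subset_left

theorem IsNecklace.infinite {N : Set S} (hN : 𝒮.IsNecklace N) : N.Infinite := by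
  obtain ⟨-, H, h⟩ := hN
  choose f hf using h.nonempty
  refine Set.infinite_of_injective_forall_mem (f := fun n : ℕ => f (2 * n)) ?_ ?_
  · intro i j hij
    have h1 : (H (2 * i) ∩ H (2 * j)).Nonempty :=
      ⟨f (2 * i), hf _, by have := hf (2 * j); simp only at hij; rwa [← hij] at this⟩
    have := (h.inter_nonempty_iff _ _).1 h1
    omega
  · intro n
    rw [h.eq_iUnion]
    exact Set.mem_iUnion.2 ⟨_, hf _⟩

theorem IsWitness.isConnected_tail {H : ℕ → Set S} {N : Set S} (h : 𝒮.IsWitness H N) (m : ℕ) :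
    𝒮.IsConnected (⋃ n ≥ m, H n) := by
  have key : ∀ k, 𝒮.IsConnected (⋃ n ∈ Set.Icc m (m + k), H n) := by
    intro k
    induction k with
    | zero => simpa using h.isConnected m
    | succ k ih =>
      have he : (⋃ n ∈ Set.Icc m (m + (k + 1)), H n)
          = (⋃ n ∈ Set.Icc m (m + k), H n) ∪ H (m + k + 1) := by
        ext x
        simp only [Set.mem_iUnion, Set.mem_union, Set.mem_Icc, exists_prop]
        constructor
        · rintro ⟨n, ⟨h1, h2⟩, hx⟩
          by_cases hn : n = m + k + 1
          · exact Or.inr (hn ▸ hx)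
          · exact Or.inl ⟨n, ⟨h1, by omega⟩, hx⟩
        · rintro (⟨n, ⟨h1, h2⟩, hx⟩ | hx)
          · exact ⟨n, ⟨h1, by omega⟩, hx⟩
          · exact ⟨m + k + 1, ⟨by omega, by omega⟩, hx⟩
      rw [he]
      refine ih.union (h.isConnected _) ?_
      obtain ⟨x, hx, hx'⟩ := (h.inter_nonempty_iff (m + k) (m + k + 1)).2 ⟨by omega, by omega⟩
      exact ⟨x, Set.mem_biUnion (Set.mem_Icc.2 ⟨by omega, le_rfl⟩) hx, hx'⟩
  intro x hx y hy
  simp only [Set.mem_iUnion, exists_prop] at hx hy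
  obtain ⟨i, hi, hx⟩ := hx
  obtain ⟨j, hj, hy⟩ := hy
  obtain ⟨F, hF, hs, h1, h2⟩ := key (i + j) x
    (Set.mem_biUnion (Set.mem_Icc.2 ⟨hi, by omega⟩) hx) y
    (Set.mem_biUnion (Set.mem_Icc.2 ⟨hj, by omega⟩) hy)
  refine ⟨F, hF, hs.trans ?_, h1, h2⟩
  exact Set.biUnion_subset_biUnion_left fun n hn => hn.1

theorem IsWitness.exists_disjoint {H : ℕ → Set S} {N : Set S} (h : 𝒮.IsWitness H N) {X : Set S}
    (hX : X.Finite) : ∃ m, ∀ n ≥ m, Disjoint (H n) X := by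
  induction X, hX using Set.Finite.induction_on with
  | empty => exact ⟨0, fun n _ => Set.disjoint_empty _⟩
  | @insert a X _ _ ih =>
    obtain ⟨m, hm⟩ := ih
    by_cases ha : ∃ k, a ∈ H k
    · obtain ⟨k, hk⟩ := ha
      refine ⟨m + k + 2, fun n hn => Set.disjoint_insert_right.2 ⟨fun han => ?_, hm n (by omega)⟩⟩
      have := (h.inter_nonempty_iff n k).1 ⟨a, han, hk⟩
      omega
    · exact ⟨m, fun n hn => Set.disjoint_insert_right.2 ⟨fun han => ha ⟨n, han⟩, hm n hn⟩⟩

/-- Every necklace has an `X`-tail, and it lies in a component of `S \ X`. -/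
theorem IsNecklace.exists_tailIn {N : Set S} (hN : 𝒮.IsNecklace N) {X : Set S} (hX : X.Finite) :
    ∃ K, 𝒮.IsComponent Xᶜ K ∧ 𝒮.TailIn X N K := by
  obtain ⟨-, H, h⟩ := hN
  obtain ⟨m, hm⟩ := h.exists_disjoint hX
  have hsub : (⋃ n ≥ m, H n) ⊆ N \ X := by
    intro x hx
    simp only [Set.mem_iUnion, exists_prop] at hx
    obtain ⟨n, hn, hx⟩ := hx
    exact ⟨h.eq_iUnion ▸ Set.mem_iUnion.2 ⟨n, hx⟩, Set.disjoint_left.1 (hm n hn) hx⟩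
  have hne : (⋃ n ≥ m, H n).Nonempty := by
    obtain ⟨x, hx⟩ := h.nonempty m
    exact ⟨x, Set.mem_biUnion (show m ≥ m from le_rfl) hx⟩
  obtain ⟨T, hT, hsT⟩ := (h.isConnected_tail m).exists_isComponent hne hsub
  obtain ⟨K, hK, hTK⟩ := hT.prop.2.2.exists_isComponent hT.prop.1
    (hT.prop.2.1.trans fun x hx => hx.2 : T ⊆ Xᶜ)
  refine ⟨K, hK, T, ⟨hT, ?_⟩, hTK⟩
  refine ((Set.finite_Iio m).biUnion fun n _ => h.finite n).subset ?_
  rintro x ⟨hxN, hxT⟩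
  rw [h.eq_iUnion] at hxN
  obtain ⟨n, hn⟩ := Set.mem_iUnion.1 hxN
  refine Set.mem_biUnion (show n ∈ Set.Iio m from ?_) hn
  by_contra hlt
  exact hxT (hsT (Set.mem_biUnion (show n ≥ m from not_lt.1 hlt) hn))

theorem TailIn.eq {N : Set S} (hN : 𝒮.IsNecklace N) {X K K' : Set S} (hK : 𝒮.IsComponent Xᶜ K)
    (hK' : 𝒮.IsComponent Xᶜ K') (h : 𝒮.TailIn X N K) (h' : 𝒮.TailIn X N K') : K = K' := by
  obtain ⟨T, ⟨-, hT⟩, hTK⟩ := h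
  obtain ⟨T', ⟨-, hT'⟩, hTK'⟩ := h'
  obtain ⟨x, hxN, hx⟩ := (hN.infinite.sdiff (hT.union hT')).nonempty
  refine hK.eq_of_inter_nonempty hK' ⟨x, hTK ?_, hTK' ?_⟩
  · by_contra hxT
    exact hx (Or.inl ⟨hxN, hxT⟩)
  · by_contra hxT
    exact hx (Or.inr ⟨hxN, hxT⟩)

variable (𝒮)

/-- Equivalence of necklaces. -/
def necklaceSetoid : Setoid 𝒮.Necklace where
  r N N' := 𝒮.Equivalent N.1 N'.1
  iseqv :=
    { refl := fun N _ hX => by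
        obtain ⟨K, hK, h⟩ := N.2.exists_tailIn hX
        exact ⟨K, hK, h, h⟩
      symm := fun h X hX => by
        obtain ⟨K, hK, h1, h2⟩ := h X hX
        exact ⟨K, hK, h2, h1⟩
      trans := fun {_ N' _} h h' X hX => by
        obtain ⟨K, hK, h1, h2⟩ := h X hX
        obtain ⟨K', hK', h1', h2'⟩ := h' X hX
        obtain rfl := TailIn.eq N'.2 hK hK' h2 h1'
        exact ⟨K, hK, h1, h2'⟩ }

/-- The set of ends of a connectoid: the equivalence classes of its necklaces. -/
def EndSpace : Type _ := Quotient 𝒮.necklaceSetoid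

/-- The end that a necklace represents. -/
def Necklace.toEnd {𝒮 : Connectoid S} (N : 𝒮.Necklace) : 𝒮.EndSpace :=
  Quotient.mk 𝒮.necklaceSetoid N

/-- For a finite set `X` and a component `K` of `S \ X`, the set of all ends `ω` with
`K(X, ω) = K`, i.e. such that `K` contains the `X`-tails of all necklaces in `ω`. -/
def basicOpen (X K : Set S) : Set 𝒮.EndSpace :=
  {ω | ∀ N : 𝒮.Necklace, N.toEnd = ω → 𝒮.TailIn X N.1 K}

/-- The topology of the end space of a connectoid. -/
instance : TopologicalSpace 𝒮.EndSpace :=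
  TopologicalSpace.generateFrom
    {O | ∃ X K : Set S, X.Finite ∧ 𝒮.IsComponent Xᶜ K ∧ O = 𝒮.basicOpen X K}

end Connectoid

namespace Digraph

variable {V : Type*} (D : Digraph V)

/-- The subdigraph of `D` induced on `C` is strongly connected: for all `x, y ∈ C` there is a
directed walk from `x` to `y` in it. -/
def IsStronglyConnectedOn (C : Set V) : Prop :=
  ∀ x ∈ C, ∀ y ∈ C, Relation.ReflTransGen (fun a b => a ∈ C ∧ b ∈ C ∧ D.Adj a b) x y

/-- `K` is the vertex set of a strong component (a maximal strongly connected subdigraph) of the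
subdigraph of `D` induced on `U`. -/
def IsStrongComponent (U K : Set V) : Prop :=
  Maximal (fun C : Set V => C.Nonempty ∧ C ⊆ U ∧ D.IsStronglyConnectedOn C) K

/-- A directed ray in `D`, given by the sequence of its distinct vertices. -/
structure DiRay where
  /-- The vertices in the order of the ray. -/
  vert : ℕ → V
  injective : Function.Injective vert
  adj : ∀ n, D.Adj (vert n) (vert (n + 1))

variable {D} in
/-- The ray `R` has a tail in (the subdigraph induced on) `K`. -/
def DiRay.HasTailIn (R : D.DiRay) (K : Set V) : Prop :=
  ∃ m, ∀ n ≥ m, R.vert n ∈ K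

variable {D} in
/-- A directed ray is solid if for every finite `A` it has a tail in a strong component
of `D - A`. -/
def DiRay.IsSolid (R : D.DiRay) : Prop :=
  ∀ A : Set V, A.Finite → ∃ K, D.IsStrongComponent Aᶜ K ∧ R.HasTailIn K

/-- The solid directed rays in `D`. -/
def SolidRay : Type _ := {R : D.DiRay // R.IsSolid}

variable {D}

/-- Two rays are equivalent if for every finite `A` they have a tail in the same strong component
of `D - A`. -/
def DiRay.Equivalent (R R' : D.DiRay) : Prop :=
  ∀ A : Set V, A.Finite → ∃ K, D.IsStrongComponent Aᶜ K ∧ R.HasTailIn K ∧ R'.HasTailIn K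

theorem IsStronglyConnectedOn.union {C C' : Set V} (h : D.IsStronglyConnectedOn C)
    (h' : D.IsStronglyConnectedOn C') (hne : (C ∩ C').Nonempty) :
    D.IsStronglyConnectedOn (C ∪ C') := by
  obtain ⟨z, hz, hz'⟩ := hne
  have key : ∀ x ∈ C ∪ C',
      Relation.ReflTransGen (fun a b => a ∈ C ∪ C' ∧ b ∈ C ∪ C' ∧ D.Adj a b) x z ∧
      Relation.ReflTransGen (fun a b => a ∈ C ∪ C' ∧ b ∈ C ∪ C' ∧ D.Adj a b) z x := by
    rintro x (hx | hx)
    · exact ⟨Relation.ReflTransGen.mono (fun _ _ hab => ⟨Or.inl hab.1, Or.inl hab.2.1, hab.2.2⟩)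
          _ _ (h x hx z hz),
        Relation.ReflTransGen.mono (fun _ _ hab => ⟨Or.inl hab.1, Or.inl hab.2.1, hab.2.2⟩)
          _ _ (h z hz x hx)⟩
    · exact ⟨Relation.ReflTransGen.mono (fun _ _ hab => ⟨Or.inr hab.1, Or.inr hab.2.1, hab.2.2⟩)
          _ _ (h' x hx z hz'),
        Relation.ReflTransGen.mono (fun _ _ hab => ⟨Or.inr hab.1, Or.inr hab.2.1, hab.2.2⟩)
          _ _ (h' z hz' x hx)⟩
  exact fun x hx y hy => (key x hx).1.trans (key y hy).2

theorem IsStrongComponent.eq_of_inter_nonempty {U K K' : Set V} (h : D.IsStrongComponent U K)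
    (h' : D.IsStrongComponent U K') (hne : (K ∩ K').Nonempty) : K = K' := by
  have hU : (K ∪ K').Nonempty ∧ K ∪ K' ⊆ U ∧ D.IsStronglyConnectedOn (K ∪ K') :=
    ⟨h.prop.1.inl, Set.union_subset h.prop.2.1 h'.prop.2.1, h.prop.2.2.union h'.prop.2.2 hne⟩
  rw [h.eq_of_subset hU Set.subset_union_left]
  exact (h'.eq_of_subset hU Set.subset_union_right).symm

variable (D)

/-- Equivalence of solid rays. -/
def solidRaySetoid : Setoid D.SolidRay where
  r R R' := R.1.Equivalent R'.1
  iseqv :=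
    { refl := fun R A hA => by
        obtain ⟨K, hK, h⟩ := R.2 A hA
        exact ⟨K, hK, h, h⟩
      symm := fun h A hA => by
        obtain ⟨K, hK, h1, h2⟩ := h A hA
        exact ⟨K, hK, h2, h1⟩
      trans := fun h h' A hA => by
        obtain ⟨K, hK, h1, ⟨m, hm⟩⟩ := h A hA
        obtain ⟨K', hK', ⟨m', hm'⟩, h2'⟩ := h' A hA
        obtain rfl := hK.eq_of_inter_nonempty hK'
          ⟨_, hm (m + m') (Nat.le_add_right _ _), hm' (m + m') (Nat.le_add_left _ _)⟩
        exact ⟨K, hK, h1, h2'⟩ }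

/-- The set of ends of a digraph: the equivalence classes of its solid rays. -/
def EndSpace : Type _ := Quotient D.solidRaySetoid

/-- The end that a solid ray represents. -/
def SolidRay.toEnd {D : Digraph V} (R : D.SolidRay) : D.EndSpace :=
  Quotient.mk D.solidRaySetoid R

/-- For a finite set `A` and a strong component `K` of `D - A`, the set of all ends `ω` with
`K(A, ω) = K`, i.e. such that `K` contains tails of all solid rays in `ω`. -/
def basicOpen (K : Set V) : Set D.EndSpace :=
  {ω | ∀ R : D.SolidRay, R.toEnd = ω → R.1.HasTailIn K}

/-- The topology of the end space of a digraph. -/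
instance : TopologicalSpace D.EndSpace :=
  TopologicalSpace.generateFrom
    {O | ∃ A K : Set V, A.Finite ∧ D.IsStrongComponent Aᶜ K ∧ O = D.basicOpen K}

/-- The connectoid on `V` that corresponds to the digraph `D`: it is induced by the vertex sets of
the finite strongly connected subdigraphs of `D` (and the empty set). -/
def toConnectoid : Connectoid V where
  finConn := {F | F.Finite ∧ D.IsStronglyConnectedOn F}
  finite_of_mem _ hF := hF.1
  union_mem _ hF _ hF' hne := ⟨hF.1.union hF'.1, hF.2.union hF'.2 hne⟩
  singleton_mem s := ⟨Set.finite_singleton s, by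
    rintro x rfl y rfl
    exact Relation.ReflTransGen.refl⟩
  empty_mem := ⟨Set.finite_empty, fun _ hx => hx.elim⟩

end Digraph

/-! Call a ray and a necklace parallel if, for every finite `X`, the ray has a tail in the component
of `V \ X` containing the `X`-tail of the necklace. Components on the two sides agree
(`toConnectoid_isComponent_iff`), since any two vertices of a strongly connected set lie in a finite
strongly connected subset of it.

Every necklace is parallel to a solid ray: König's lemma, applied to the edges inside its beads,
gives a ray in the necklace, and this ray eventually stays in each `X`-tail. Conversely, a solid ray
is parallel to a necklace whose beads are built recursively, each joining two vertices of the ray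
and avoiding all beads before the last one. Components are disjoint, so parallelism carries
equivalence and the condition `K(X, ω) = K` from one side to the other. The induced map on ends is
thus a bijection matching the two generating families of open sets. -/

namespace Relation

/-! ### König's lemma and finite paths -/

variable {V : Type*} {E : V → V → Prop} {x₀ : V}

/-- The vertices reachable from `x₀` by exactly `n` steps of `E`. -/
def stepsFrom (E : V → V → Prop) (x₀ : V) : ℕ → Set V
  | 0 => {x₀}
  | n + 1 => {b | ∃ a ∈ stepsFrom E x₀ n, E a b}

/-- The least number of steps of `E` from `x₀` to a vertex. -/
noncomputable def distFrom (E : V → V → Prop) (x₀ v : V) : ℕ :=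
  sInf {n | v ∈ stepsFrom E x₀ n}

theorem ReflTransGen.exists_mem_stepsFrom {v : V} (h : ReflTransGen E x₀ v) :
    ∃ n, v ∈ stepsFrom E x₀ n := by
  induction h with
  | refl => exact ⟨0, rfl⟩
  | tail _ hE ih =>
    obtain ⟨n, hn⟩ := ih
    exact ⟨n + 1, _, hn, hE⟩

/-- Every reachable vertex is reached by a path along which the distance from `x₀` grows by one in
each step. -/
theorem ReflTransGen.exists_geodesic {v : V} (h : ReflTransGen E x₀ v) :
    ReflTransGen (fun a b => E a b ∧ distFrom E x₀ b = distFrom E x₀ a + 1) x₀ v := by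
  have key : ∀ n v, v ∈ stepsFrom E x₀ n → distFrom E x₀ v = n →
      ReflTransGen (fun a b => E a b ∧ distFrom E x₀ b = distFrom E x₀ a + 1) x₀ v := by
    intro n
    induction n with
    | zero =>
      rintro v rfl -
      exact .refl
    | succ n ih =>
      rintro v ⟨a, ha, hE⟩ hv
      have h1 : distFrom E x₀ a ≤ n := Nat.sInf_le ha
      have h2 : a ∈ stepsFrom E x₀ (distFrom E x₀ a) :=
        Nat.sInf_mem (s := {n | a ∈ stepsFrom E x₀ n}) ⟨n, ha⟩
      -- Together with `h1`, this forces the predecessor of `v` to have distance exactly `n`.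
      have h3 : distFrom E x₀ v ≤ distFrom E x₀ a + 1 := Nat.sInf_le ⟨a, h2, hE⟩
      have h4 : distFrom E x₀ a = n := by omega
      exact (ih a ha h4).tail ⟨hE, by omega⟩
  exact key _ v (Nat.sInf_mem (s := {n | v ∈ stepsFrom E x₀ n}) h.exists_mem_stepsFrom) rfl

/-- **König's lemma** for directed rays: if every vertex has finitely many successors and infinitely
many vertices are reachable from `x₀`, then there is a ray starting at `x₀`. -/
theorem exists_injective_seq (hfin : ∀ a, {b | E a b}.Finite)
    (hinf : {v | ReflTransGen E x₀ v}.Infinite) :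
    ∃ f : ℕ → V, f 0 = x₀ ∧ f.Injective ∧ ∀ n, E (f n) (f (n + 1)) := by
  -- Distance increases along `T`, so every `T`-walk is injective. Unreachable vertices have the
  -- default distance `0` and are never `T`-successors.
  let T : V → V → Prop := fun a b => E a b ∧ distFrom E x₀ b = distFrom E x₀ a + 1
  have step : ∀ a : {a // {v | ReflTransGen T a v}.Infinite},
      ∃ b : {a // {v | ReflTransGen T a v}.Infinite}, T a b := by
    rintro ⟨a, ha⟩
    -- Otherwise the `T`-descendants of `a` would be `a` and a finite union of finite sets.
    by_contra! hcon
    refine ha ((((hfin a).subset fun b hb => hb.1 : {b | T a b}.Finite).biUnion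
      (t := fun b => {v | ReflTransGen T b v}) fun b hb => ?_).insert a |>.subset ?_)
    · by_contra hb'
      exact hcon ⟨b, hb'⟩ hb
    · intro v hv
      rcases ReflTransGen.cases_head hv with rfl | ⟨b, hb, hbv⟩
      · exact Set.mem_insert _ _
      · exact Set.mem_insert_of_mem _ (Set.mem_biUnion (show b ∈ {b | T a b} from hb) hbv)
  choose g hg using step
  let f : ℕ → {a // {v | ReflTransGen T a v}.Infinite} := fun n =>
    g^[n] ⟨x₀, hinf.mono fun v hv => ReflTransGen.exists_geodesic hv⟩
  have hf : ∀ n, T (f n) (f (n + 1)) := by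
    intro n
    simp only [f, Function.iterate_succ_apply']
    exact hg _
  have hmono : StrictMono fun n => distFrom E x₀ (f n).1 :=
    strictMono_nat_of_lt_succ fun n => by have := (hf n).2; omega
  exact ⟨fun n => (f n).1, rfl,
    fun i j hij => hmono.injective (congrArg (distFrom E x₀) hij), fun n => (hf n).1⟩

/-- The vertices of some path from `x` to `y` form a finite set. -/
theorem ReflTransGen.exists_finite {C : Set V} {x y : V}
    (h : ReflTransGen (fun a b => a ∈ C ∧ b ∈ C ∧ E a b) x y) (hx : x ∈ C) :
    ∃ F : Set V, F.Finite ∧ F ⊆ C ∧ x ∈ F ∧ y ∈ F ∧ ∀ z ∈ F,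
      ReflTransGen (fun a b => a ∈ F ∧ b ∈ F ∧ E a b) x z ∧
      ReflTransGen (fun a b => a ∈ F ∧ b ∈ F ∧ E a b) z y := by
  induction h with
  | refl =>
    refine ⟨{x}, Set.finite_singleton x, Set.singleton_subset_iff.2 hx, rfl, rfl, ?_⟩
    rintro z rfl
    exact ⟨.refl, .refl⟩
  | @tail b c _ hbc ih =>
    obtain ⟨F, hF, hFC, hxF, hbF, hz⟩ := ih
    have hmono : ∀ p q, ReflTransGen (fun a b => a ∈ F ∧ b ∈ F ∧ E a b) p q →
        ReflTransGen (fun a b => a ∈ insert c F ∧ b ∈ insert c F ∧ E a b) p q := fun p q =>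
      ReflTransGen.mono (fun _ _ h => ⟨Or.inr h.1, Or.inr h.2.1, h.2.2⟩) p q
    have hlast : ReflTransGen (fun a b => a ∈ insert c F ∧ b ∈ insert c F ∧ E a b) b c :=
      .single ⟨Or.inr hbF, Or.inl rfl, hbc.2.2⟩
    refine ⟨insert c F, hF.insert c, Set.insert_subset hbc.2.1 hFC, Or.inr hxF, Or.inl rfl, ?_⟩
    rintro z (rfl | hzF)
    · exact ⟨(hmono _ _ (hz b hbF).1).trans hlast, .refl⟩
    · exact ⟨hmono _ _ (hz z hzF).1, (hmono _ _ (hz z hzF).2).trans hlast⟩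

end Relation

/-! ### Parallel rays and necklaces -/

namespace Digraph

variable {V : Type*} {D : Digraph V}

/-- The union of a path from `x` to `y` and a path back is strongly connected: each of its vertices
is reached from `x` and reaches `x`. -/
theorem IsStronglyConnectedOn.exists_finite {C : Set V} (hC : D.IsStronglyConnectedOn C) {x y : V}
    (hx : x ∈ C) (hy : y ∈ C) :
    ∃ F : Set V, F.Finite ∧ D.IsStronglyConnectedOn F ∧ F ⊆ C ∧ x ∈ F ∧ y ∈ F := by
  obtain ⟨F, hF, hFC, hxF, hyF, h⟩ := (hC x hx y hy).exists_finite hx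
  obtain ⟨G, hG, hGC, hyG, hxG, h'⟩ := (hC y hy x hx).exists_finite hy
  have hl : ∀ p q, Relation.ReflTransGen (fun a b => a ∈ F ∧ b ∈ F ∧ D.Adj a b) p q →
      Relation.ReflTransGen (fun a b => a ∈ F ∪ G ∧ b ∈ F ∪ G ∧ D.Adj a b) p q :=
    Relation.ReflTransGen.mono fun _ _ h => ⟨Or.inl h.1, Or.inl h.2.1, h.2.2⟩
  have hr : ∀ p q, Relation.ReflTransGen (fun a b => a ∈ G ∧ b ∈ G ∧ D.Adj a b) p q →
      Relation.ReflTransGen (fun a b => a ∈ F ∪ G ∧ b ∈ F ∪ G ∧ D.Adj a b) p q :=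
    Relation.ReflTransGen.mono fun _ _ h => ⟨Or.inr h.1, Or.inr h.2.1, h.2.2⟩
  have key : ∀ z ∈ F ∪ G,
      Relation.ReflTransGen (fun a b => a ∈ F ∪ G ∧ b ∈ F ∪ G ∧ D.Adj a b) x z ∧
      Relation.ReflTransGen (fun a b => a ∈ F ∪ G ∧ b ∈ F ∪ G ∧ D.Adj a b) z x := by
    rintro z (hz | hz)
    · exact ⟨hl _ _ (h z hz).1, (hl _ _ (h z hz).2).trans (hr _ _ (h' x hxG).1)⟩
    · exact ⟨(hl _ _ (h y hyF).1).trans (hr _ _ (h' z hz).1), hr _ _ (h' z hz).2⟩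
  exact ⟨F ∪ G, hF.union hG, fun a ha b hb => (key a ha).2.trans (key b hb).1,
    Set.union_subset hFC hGC, Or.inl hxF, Or.inl hyF⟩

theorem toConnectoid_isConnected_iff {C : Set V} :
    D.toConnectoid.IsConnected C ↔ D.IsStronglyConnectedOn C := by
  constructor
  · intro h x hx y hy
    obtain ⟨F, hF, hFC, hxF, hyF⟩ := h x hx y hy
    exact Relation.ReflTransGen.mono (fun _ _ h => ⟨hFC h.1, hFC h.2.1, h.2.2⟩) _ _
      (hF.2 x hxF y hyF)
  · intro h x hx y hy
    obtain ⟨F, hF, hFs, hFC, hxF, hyF⟩ := h.exists_finite hx hy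
    exact ⟨F, ⟨hF, hFs⟩, hFC, hxF, hyF⟩

theorem toConnectoid_isComponent_iff {U K : Set V} :
    D.toConnectoid.IsComponent U K ↔ D.IsStrongComponent U K := by
  simp only [Connectoid.IsComponent, IsStrongComponent, toConnectoid_isConnected_iff]

/-- A ray and a set are parallel if for every finite `X` the ray has a tail in the same component
of `V \ X` as the `X`-tail of the set. -/
def DiRay.Parallel (R : D.DiRay) (N : Set V) : Prop :=
  ∀ X : Set V, X.Finite → ∃ K, D.IsStrongComponent Xᶜ K ∧ R.HasTailIn K ∧
    D.toConnectoid.TailIn X N K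

theorem DiRay.HasTailIn.eq {R : D.DiRay} {U K K' : Set V} (hK : D.IsStrongComponent U K)
    (hK' : D.IsStrongComponent U K') (h : R.HasTailIn K) (h' : R.HasTailIn K') : K = K' := by
  obtain ⟨m, hm⟩ := h
  obtain ⟨m', hm'⟩ := h'
  exact hK.eq_of_inter_nonempty hK'
    ⟨_, hm (m + m') (Nat.le_add_right _ _), hm' (m + m') (Nat.le_add_left _ _)⟩

/-- Only one component can contain a tail of `R`, and only one the `X`-tail of `N`; parallelism says
that they coincide. -/
theorem DiRay.Parallel.hasTailIn_iff {R : D.DiRay} {N : Set V} (h : R.Parallel N)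
    (hN : D.toConnectoid.IsNecklace N) {X K : Set V} (hX : X.Finite)
    (hK : D.IsStrongComponent Xᶜ K) : R.HasTailIn K ↔ D.toConnectoid.TailIn X N K := by
  obtain ⟨L, hL, hR, hT⟩ := h X hX
  constructor
  · intro h'
    rwa [h'.eq hK hL hR]
  · intro h'
    rwa [h'.eq hN (toConnectoid_isComponent_iff.2 hK) (toConnectoid_isComponent_iff.2 hL) hT]

theorem DiRay.Parallel.equivalent_iff {R R' : D.DiRay} {N N' : Set V} (h : R.Parallel N)
    (h' : R'.Parallel N') (hN : D.toConnectoid.IsNecklace N)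
    (hN' : D.toConnectoid.IsNecklace N') :
    R.Equivalent R' ↔ D.toConnectoid.Equivalent N N' := by
  refine forall₂_congr fun X hX => exists_congr fun K => ?_
  rw [toConnectoid_isComponent_iff]
  exact and_congr_right fun hK =>
    and_congr (h.hasTailIn_iff hN hX hK) (h'.hasTailIn_iff hN' hX hK)

/-- Every necklace is parallel to a solid ray. -/
theorem exists_solidRay_parallel {N : Set V} (hN : D.toConnectoid.IsNecklace N) :
    ∃ R : D.SolidRay, R.1.Parallel N := by
  obtain ⟨hNc, H, hH⟩ := id hN
  have hHN : ∀ n, H n ⊆ N := fun n => hH.eq_iUnion ▸ Set.subset_iUnion H n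
  -- Vertices of `D` may have infinitely many out-neighbours. Each vertex lies in only finitely many
  -- finite beads, so restricting to edges within beads gives finite out-degree.
  let E : V → V → Prop := fun a b => ∃ n, a ∈ H n ∧ b ∈ H n ∧ D.Adj a b
  have hEmono : ∀ n, ∀ x ∈ H n, ∀ y ∈ H n, Relation.ReflTransGen E x y := fun n x hx y hy =>
    Relation.ReflTransGen.mono (fun _ _ h => ⟨n, h⟩) _ _
      (toConnectoid_isConnected_iff.1 (hH.isConnected n) x hx y hy)
  have hfin : ∀ a, {b | E a b}.Finite := by
    intro a
    obtain ⟨m, hm⟩ := hH.exists_disjoint (Set.finite_singleton a)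
    refine ((Set.finite_Iio m).biUnion fun n _ => hH.finite n).subset ?_
    rintro b ⟨n, ha, hb, -⟩
    refine Set.mem_biUnion (show n ∈ Set.Iio m from ?_) hb
    by_contra hlt
    exact Set.disjoint_left.1 (hm n (not_lt.1 hlt)) ha rfl
  obtain ⟨x₀, hx₀⟩ := hH.nonempty 0
  have hreach : ∀ n, ∀ y ∈ H n, Relation.ReflTransGen E x₀ y := by
    intro n
    induction n with
    | zero => exact hEmono 0 x₀ hx₀
    | succ n ih =>
      intro y hy
      obtain ⟨z, hz, hz'⟩ := (hH.inter_nonempty_iff n (n + 1)).2 ⟨by omega, by omega⟩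
      exact (ih z hz).trans (hEmono (n + 1) z hz' y hy)
  obtain ⟨f, -, hinj, hadj⟩ := Relation.exists_injective_seq hfin
    (hN.infinite.mono fun y hy => by
      rw [hH.eq_iUnion] at hy
      obtain ⟨n, hn⟩ := Set.mem_iUnion.1 hy
      exact hreach n y hn : {v | Relation.ReflTransGen E x₀ v}.Infinite)
  let R : D.DiRay := ⟨f, hinj, fun n => (hadj n).choose_spec.2.2⟩
  have hfN : ∀ n, f n ∈ N := fun n => hHN _ (hadj n).choose_spec.1
  have hleave : ∀ B : Set V, B.Finite → ∃ m, ∀ n ≥ m, f n ∉ B := by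
    intro B hB
    obtain ⟨m, hm⟩ := (hB.preimage hinj.injOn).bddAbove
    exact ⟨m + 1, fun n hn hB' => absurd (hm hB') (by omega)⟩
  -- The ray stays in `N` and leaves the finite set `N \ T`, hence ends up in `T`. Solidity follows
  -- from this.
  have hpar : R.Parallel N := by
    intro X hX
    obtain ⟨K, hK, T, ⟨hT, hTfin⟩, hTK⟩ := hN.exists_tailIn hX
    obtain ⟨m, hm⟩ := hleave _ hTfin
    exact ⟨K, toConnectoid_isComponent_iff.1 hK,
      ⟨m, fun n hn => hTK (by_contra fun h => hm n hn ⟨hfN n, h⟩)⟩, T, ⟨hT, hTfin⟩, hTK⟩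
  exact ⟨⟨R, fun X hX => let ⟨K, hK, h, _⟩ := hpar X hX; ⟨K, hK, h⟩⟩, hpar⟩

/-- Every solid ray is parallel to a necklace. -/
theorem DiRay.IsSolid.exists_necklace_parallel {R : D.DiRay} (hR : R.IsSolid) :
    ∃ N : D.toConnectoid.Necklace, R.Parallel N.1 := by
  -- A state consists of an index on the ray, the union of the earlier beads, and the current bead.
  let Inv : ℕ × Set V × Set V → Prop := fun s => s.2.1.Finite ∧ s.2.2.Finite ∧
    D.IsStronglyConnectedOn s.2.2 ∧ R.vert s.1 ∈ s.2.2 ∧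
    ∃ K, D.IsStrongComponent s.2.1ᶜ K ∧ ∀ n ≥ s.1, R.vert n ∈ K
  have step : ∀ s : {s // Inv s}, ∃ t : {s // Inv s}, s.1.1 < t.1.1 ∧
      t.1.2.1 = s.1.2.1 ∪ s.1.2.2 ∧ t.1.2.2 ⊆ s.1.2.1ᶜ ∧ R.vert s.1.1 ∈ t.1.2.2 := by
    rintro ⟨⟨m, A, B⟩, hA, hB, hBc, hmB, K, hK, hmK⟩
    -- The new bead lies in `K`, so it avoids `A`, and it meets `B` in the ray vertex of index `m`.
    -- The new index `m + p + 1` exceeds `m` and lies past `p`, where the ray is already in `L`.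
    obtain ⟨L, hL, p, hp⟩ := hR (A ∪ B) (hA.union hB)
    obtain ⟨F, hF, hFc, hFK, h1, h2⟩ := hK.prop.2.2.exists_finite (hmK m le_rfl)
      (hmK (m + p + 1) (by simp only [ge_iff_le]; omega))
    exact ⟨⟨⟨m + p + 1, A ∪ B, F⟩, hA.union hB, hF, hFc, h2, L, hL,
      fun n hn => hp n (by simp only [ge_iff_le] at hn ⊢; omega)⟩, by simp only; omega, rfl,
      hFK.trans hK.prop.2.1, h1⟩
  choose g hlt hg using step
  obtain ⟨K₀, hK₀, m₀, hm₀⟩ := hR ∅ Set.finite_empty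
  let s : ℕ → {s // Inv s} := fun n => g^[n] ⟨⟨m₀, ∅, {R.vert m₀}⟩, Set.finite_empty,
    Set.finite_singleton _, by
      rintro x rfl y rfl
      exact .refl, rfl, K₀, hK₀, hm₀⟩
  have hs : ∀ n, s (n + 1) = g (s n) := fun n => Function.iterate_succ_apply' _ _ _
  let m : ℕ → ℕ := fun n => (s n).1.1
  let A : ℕ → Set V := fun n => (s n).1.2.1
  let H : ℕ → Set V := fun n => (s n).1.2.2
  have hm : StrictMono m := strictMono_nat_of_lt_succ fun n => by
    simp only [m, hs]
    exact hlt _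
  have hA : ∀ n, A (n + 1) = A n ∪ H n := fun n => by
    simp only [A, H, hs]
    exact (hg _).1
  have hHA : ∀ n, H (n + 1) ⊆ (A n)ᶜ := fun n => by
    simp only [A, H, hs]
    exact (hg _).2.1
  have hmH' : ∀ n, R.vert (m n) ∈ H (n + 1) := fun n => by
    simp only [m, H, hs]
    exact (hg _).2.2
  have hmH : ∀ n, R.vert (m n) ∈ H n := fun n => (s n).2.2.2.2.1
  have hAmono : Monotone A := monotone_nat_of_le_succ fun n => by
    rw [hA]
    exact Set.subset_union_left
  -- `H i ⊆ A (i + 1) ⊆ A (j - 1)`, and `H j` avoids the last set.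
  have hfar : ∀ i j, i + 2 ≤ j → ¬ (H i ∩ H j).Nonempty := by
    rintro i (_ | j) hij ⟨x, hxi, hxj⟩
    · omega
    · refine hHA j hxj (hAmono (show i + 1 ≤ j by omega) ?_)
      rw [hA]
      exact Or.inr hxi
  have hW : D.toConnectoid.IsWitness H (⋃ n, H n) := by
    refine ⟨fun n => (s n).2.2.1, fun n => toConnectoid_isConnected_iff.2 (s n).2.2.2.1, rfl, ?_⟩
    intro i j
    constructor
    · intro h
      by_contra hcon
      rcases Nat.lt_or_ge i j with h' | h'
      · exact hfar i j (by omega) h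
      · exact hfar j i (by omega) (Set.inter_comm _ _ ▸ h)
    · rintro ⟨h1, h2⟩
      obtain rfl | rfl | rfl : i = j ∨ i = j + 1 ∨ j = i + 1 := by omega
      · exact ⟨_, hmH i, hmH i⟩
      · exact ⟨_, hmH' j, hmH j⟩
      · exact ⟨_, hmH i, hmH' i⟩
  have hN : D.toConnectoid.IsNecklace (⋃ n, H n) :=
    ⟨by simpa using hW.isConnected_tail 0, H, hW⟩
  refine ⟨⟨_, hN⟩, fun X hX => ?_⟩
  obtain ⟨K, hK, hT⟩ := hN.exists_tailIn hX
  obtain ⟨L, hL, p, hp⟩ := hR X hX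
  obtain ⟨T, ⟨-, hTfin⟩, hTK⟩ := id hT
  -- The necklace need not contain a tail of the ray, but it contains the vertices of index `m n`.
  -- All but finitely many of these lie in `T`, so one beyond `p` lies in both components.
  obtain ⟨q, hq⟩ := (hTfin.preimage (R.injective.comp hm.injective).injOn).bddAbove
  have hmem : R.vert (m (p + q + 1)) ∈ T := by
    by_contra h
    have := hq (show p + q + 1 ∈ R.vert ∘ m ⁻¹' _ from ⟨Set.mem_iUnion.2 ⟨_, hmH _⟩, h⟩)
    omega
  have hle : p ≤ m (p + q + 1) := le_trans (by omega : p ≤ p + q + 1) (hm.id_le _)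
  obtain rfl := hL.eq_of_inter_nonempty (toConnectoid_isComponent_iff.1 hK)
    ⟨_, hp _ hle, hTK hmem⟩
  exact ⟨L, hL, ⟨p, hp⟩, hT⟩

/-- One representative suffices, as equivalent rays have tails in the same component of `D - A`. -/
theorem SolidRay.toEnd_mem_basicOpen_iff {R : D.SolidRay} {A K : Set V} (hA : A.Finite)
    (hK : D.IsStrongComponent Aᶜ K) : R.toEnd ∈ D.basicOpen K ↔ R.1.HasTailIn K := by
  refine ⟨fun h => h R rfl, fun h R' hR' => ?_⟩
  have heq : R'.1.Equivalent R.1 := Quotient.exact hR'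
  obtain ⟨L, hL, h1, h2⟩ := heq A hA
  rwa [h.eq hK hL h2]

end Digraph

theorem Connectoid.Necklace.toEnd_mem_basicOpen_iff {S : Type*} {𝒮 : Connectoid S}
    {N : 𝒮.Necklace} {X K : Set S} (hX : X.Finite) (hK : 𝒮.IsComponent Xᶜ K) :
    N.toEnd ∈ 𝒮.basicOpen X K ↔ 𝒮.TailIn X N.1 K := by
  refine ⟨fun h => h N rfl, fun h N' hN' => ?_⟩
  have heq : 𝒮.Equivalent N'.1 N.1 := Quotient.exact hN'
  obtain ⟨L, hL, h1, h2⟩ := heq X hX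
  rwa [h.eq N.2 hK hL h2]

/-! ### The homeomorphism -/

namespace Digraph

variable {V : Type*} (D : Digraph V)

/-- The map that sends the end of a solid ray to the end of the necklaces parallel to it. -/
noncomputable def toConnectoidEnd : D.EndSpace → D.toConnectoid.EndSpace :=
  Quotient.lift (fun R : D.SolidRay => R.2.exists_necklace_parallel.choose.toEnd)
    fun R R' h => Quotient.sound
      ((R.2.exists_necklace_parallel.choose_spec.equivalent_iff
        R'.2.exists_necklace_parallel.choose_spec
        R.2.exists_necklace_parallel.choose.2 R'.2.exists_necklace_parallel.choose.2).1 h)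

variable {D}

/-- The choice of necklace is immaterial: necklaces parallel to the same ray are equivalent. -/
theorem toConnectoidEnd_toEnd {R : D.SolidRay} {N : D.toConnectoid.Necklace}
    (h : R.1.Parallel N.1) : D.toConnectoidEnd R.toEnd = N.toEnd :=
  Quotient.sound ((R.2.exists_necklace_parallel.choose_spec.equivalent_iff h
    R.2.exists_necklace_parallel.choose.2 N.2).1 (D.solidRaySetoid.refl R))

theorem toConnectoidEnd_bijective : Function.Bijective D.toConnectoidEnd := by
  constructor
  · rintro ⟨R⟩ ⟨R'⟩ h
    obtain ⟨N, hN⟩ := R.2.exists_necklace_parallel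
    obtain ⟨N', hN'⟩ := R'.2.exists_necklace_parallel
    have h' : N.toEnd = N'.toEnd :=
      (toConnectoidEnd_toEnd hN).symm.trans (h.trans (toConnectoidEnd_toEnd hN'))
    exact Quotient.sound ((hN.equivalent_iff hN' N.2 N'.2).2 (Quotient.exact h'))
  · rintro ⟨N⟩
    obtain ⟨R, hR⟩ := exists_solidRay_parallel N.2
    exact ⟨R.toEnd, toConnectoidEnd_toEnd hR⟩

theorem toConnectoidEnd_preimage_basicOpen {X K : Set V} (hX : X.Finite)
    (hK : D.IsStrongComponent Xᶜ K) :
    D.toConnectoidEnd ⁻¹' D.toConnectoid.basicOpen X K = D.basicOpen K := by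
  ext ⟨R⟩
  obtain ⟨N, hN⟩ := R.2.exists_necklace_parallel
  change D.toConnectoidEnd R.toEnd ∈ D.toConnectoid.basicOpen X K ↔ R.toEnd ∈ D.basicOpen K
  rw [toConnectoidEnd_toEnd hN,
    Connectoid.Necklace.toEnd_mem_basicOpen_iff hX (toConnectoid_isComponent_iff.2 hK),
    SolidRay.toEnd_mem_basicOpen_iff hX hK, hN.hasTailIn_iff N.2 hX hK]

/-- The induced topology is generated by preimages of generators, and these are exactly the
generators on the digraph side. -/
theorem isInducing_toConnectoidEnd : Topology.IsInducing D.toConnectoidEnd := by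
  constructor
  change _ = TopologicalSpace.induced _ (TopologicalSpace.generateFrom _)
  rw [induced_generateFrom_eq]
  change TopologicalSpace.generateFrom _ = _
  congr 1
  ext O
  constructor
  · rintro ⟨X, K, hX, hK, rfl⟩
    exact ⟨_, ⟨X, K, hX, toConnectoid_isComponent_iff.2 hK, rfl⟩,
      toConnectoidEnd_preimage_basicOpen hX hK⟩
  · rintro ⟨_, ⟨X, K, hX, hK, rfl⟩, rfl⟩
    exact ⟨X, K, hX, toConnectoid_isComponent_iff.1 hK,
      toConnectoidEnd_preimage_basicOpen hX (toConnectoid_isComponent_iff.1 hK)⟩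

end Digraph

theorem lemma4p4 {V : Type*} (D : Digraph V) :
    Nonempty (D.EndSpace ≃ₜ D.toConnectoid.EndSpace) :=
  ⟨(Equiv.ofBijective _ D.toConnectoidEnd_bijective).toHomeomorphOfIsInducing
    Digraph.isInducing_toConnectoidEnd⟩
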